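/- Let $k\ge 2$. A $k$-Pell string is a word over the alphabet $\{0,1,\ldots,k-1,kk\}$, i.e. a concatenation of one-letter strings $0,1,\ldots,k-1$ and the two-letter string $kk$ (which counts $2$ towards the length). For $n\ge 0$, the $k$-Pell graph $\Pi_{n,k}$ has as vertices the $k$-Pell strings of length $n$; two of them are adjacent if one can be obtained from the other by replacing one letter $i$ with $i+1$, where $i\in\{0,1,\ldots,k-2\}$, or by replacing one factor $(k-1)(k-1)$ with $kk$. The cube polynomial of a finite graph $G$ is $C_G(x)=\sum_{i\ge 0}c_i(G)x^i$, where $c_i(G)$ is the number of induced subgraphs of $G$ isomorphic to the $i$-dimensional hypercube $Q_i$ ($Q_0$ being a single vertex). Then the generating function of the sequence $\{C_{\Pi_{n,k}}(x)\}_{n\ge 0}$ is $$\sum_{n\ge 0}C_{\Pi_{n,k}}(x)\,t^n=\frac{1}{1-\bigl(k+(k-1)x\bigr)t-(1+x)t^2},$$ an identity of formal power series in $t$ over $\mathbb{Z}[x]$ (the denominator being invertible there). -/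

import Mathlib

namespace KPell

/-- `IsPellString k w`: the string `w` is a word over the alphabet `{0, 1, …, k-1, kk}`, i.e. a
concatenation of the one-letter strings `0, …, k-1` and the two-letter string `kk`. -/
inductive IsPellString (k : ℕ) : List ℕ → Prop
  | nil : IsPellString k []
  | letter (a : ℕ) (w : List ℕ) : a < k → IsPellString k w → IsPellString k (a :: w)
  | double (w : List ℕ) : IsPellString k w → IsPellString k (k :: k :: w)

/-- The set of `k`-Pell strings of length `n`; the block `kk` contributes `2` to the length. -/
abbrev PellString (n k : ℕ) : Type :=
  {w : List ℕ // IsPellString k w ∧ w.length = n}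

theorem IsPellString.le {k : ℕ} {w : List ℕ} (h : IsPellString k w) : ∀ a ∈ w, a ≤ k := by
  induction h with
  | nil => simp
  | letter a w ha _ ih => simpa using ⟨ha.le, ih⟩
  | double w _ ih => simpa using ih

instance instFinitePellString (n k : ℕ) : Finite (PellString n k) := by
  have hfin : Finite {l : List (Fin (k + 1)) // l.length = n} :=
    (List.finite_length_eq (Fin (k + 1)) n).to_subtype
  refine Finite.of_surjective
    (α := {l : {l : List (Fin (k + 1)) // l.length = n} //
      IsPellString k (l.1.map Fin.val)})
    (fun l => ⟨l.1.1.map Fin.val, l.2, by simpa using l.1.2⟩) ?_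
  rintro ⟨w, hw, hn⟩
  have hmap : ((w.attach.map fun a => (⟨a.1, Nat.lt_succ_of_le (hw.le a.1 a.2)⟩ :
      Fin (k + 1))).map Fin.val) = w := by
    simp [List.map_map, Function.comp_def]
  exact ⟨⟨⟨w.attach.map fun a => ⟨a.1, Nat.lt_succ_of_le (hw.le a.1 a.2)⟩, by simpa using hn⟩,
    by rw [hmap]; exact hw⟩, Subtype.ext hmap⟩

/-- `Step k u v`: the string `v` is obtained from `u` by replacing one letter `i`, where
`0 ≤ i ≤ k - 2`, with `i + 1`, or by replacing one factor `(k-1)(k-1)` with `kk`. -/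
def Step (k : ℕ) (u v : List ℕ) : Prop :=
  (∃ (p s : List ℕ) (i : ℕ), i + 1 < k ∧ u = p ++ [i] ++ s ∧ v = p ++ [i + 1] ++ s) ∨
  (∃ p s : List ℕ, 1 ≤ k ∧ u = p ++ [k - 1, k - 1] ++ s ∧ v = p ++ [k, k] ++ s)

theorem Step.irrefl (k : ℕ) (u : List ℕ) : ¬ Step k u u := by
  rintro (⟨p, s, i, -, h1, h2⟩ | ⟨p, s, hk, h1, h2⟩)
  · have := h1.symm.trans h2
    simp at this
  · have := h1.symm.trans h2
    simp at this
    omega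

/-- The `k`-Pell graph `Π_{n,k}`. -/
def pellGraph (n k : ℕ) : SimpleGraph (PellString n k) where
  Adj u v := Step k u.1 v.1 ∨ Step k v.1 u.1
  symm := ⟨fun _ _ h => h.symm⟩
  loopless := ⟨fun u h => h.elim (Step.irrefl k u.1) (Step.irrefl k u.1)⟩

/-- The `r`-cube `Q_r`: binary vectors of length `r`, adjacent when they differ in exactly one
coordinate (so `Q_0` is a single vertex). -/
def hypercube (r : ℕ) : SimpleGraph (Fin r → Bool) where
  Adj x y := ∃! j, x j ≠ y j
  symm := ⟨fun x y h => by simpa only [ne_comm] using h⟩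
  loopless := ⟨fun x h => by obtain ⟨j, hj, -⟩ := h; exact hj rfl⟩

/-- `c_i(G)`: the number of induced `i`-cubes of `G`, that is, of vertex sets `S` such that the
induced subgraph `G[S]` is isomorphic to `Q_i`. -/
noncomputable def cubeCount {V : Type*} (G : SimpleGraph V) (i : ℕ) : ℕ :=
  Nat.card {S : Set V // Nonempty (G.induce S ≃g hypercube i)}

/-- The cube polynomial `C_G(x) = ∑_{i ≥ 0} c_i(G) x^i` of a finite graph. The sum is cut off at
`i = |V(G)|`; `coeff_cubePoly` shows that nothing is lost. -/
noncomputable def cubePoly {V : Type*} [Finite V] (G : SimpleGraph V) : Polynomial ℤ :=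
  ∑ i ∈ Finset.range (Nat.card V + 1), Polynomial.C (cubeCount G i : ℤ) * Polynomial.X ^ i

theorem cubeCount_eq_zero {V : Type*} [Finite V] (G : SimpleGraph V) {i : ℕ}
    (hi : Nat.card V < i) : cubeCount G i = 0 := by
  have : IsEmpty {S : Set V // Nonempty (G.induce S ≃g hypercube i)} := by
    refine ⟨?_⟩
    rintro ⟨S, ⟨e⟩⟩
    have h1 : Nat.card S = 2 ^ i := by simpa using Nat.card_congr e.toEquiv
    have h2 : Nat.card S ≤ Nat.card V := Nat.card_le_card_of_injective _ Subtype.val_injective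
    have h3 : i < 2 ^ i := Nat.lt_two_pow_self
    omega
  simp [cubeCount]

theorem coeff_cubePoly {V : Type*} [Finite V] (G : SimpleGraph V) (i : ℕ) :
    (cubePoly G).coeff i = (cubeCount G i : ℤ) := by
  simp only [cubePoly, Polynomial.finsetSum_coeff, Polynomial.coeff_C_mul,
    Polynomial.coeff_X_pow, mul_ite, mul_one, mul_zero, Finset.sum_ite_eq, Finset.mem_range]
  split_ifs with h
  · rfl
  · rw [cubeCount_eq_zero G (by omega)]; rfl

/-- The denominator `1 - (k + (k-1)x) t - (1+x) t²`, a formal power series in `t` over `ℤ[x]`. -/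
noncomputable def denom (k : ℕ) : PowerSeries (Polynomial ℤ) :=
  1 - PowerSeries.C ((k : Polynomial ℤ) + ((k : Polynomial ℤ) - 1) * Polynomial.X) * PowerSeries.X
    - PowerSeries.C (1 + Polynomial.X : Polynomial ℤ) * PowerSeries.X ^ 2

end KPell

namespace KPell

open Function

/-! ### Hypercubes -/

/-! Take the first letter of a nonempty Pell string as its level. Along an edge the level changes by
at most 1, and a word has at most one neighbour one level up and at most one a level down. By
`level_dichotomy` an induced cube then lies in one level or is split by a single direction between
two consecutive levels. So its words share a first block `a < k` or `kk`, or the first block runs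
through an edge `a – a+1` or `(k-1)(k-1) – kk` while the rest runs through a smaller cube.

Conversely, each of these blocks extends a cube of shorter words to a cube (`isCube_glue_block`),
and block and rest can be recovered (`glue_block_injective`, `exists_block`). There are `k` blocks
of length 1 and dimension 0, `k-1` of length 1 and dimension 1, and one of length 2 in each of these
dimensions. Hence `C_n = (k + (k-1)x) C_{n-1} + (1+x) C_{n-2}`, which is the stated generating
function. -/

theorem hypercube_adj_update {r : ℕ} (x : Fin r → Bool) {i : Fin r} {c : Bool} (hc : c ≠ x i) :
    (hypercube r).Adj x (update x i c) := by
  refine ⟨i, by simpa using hc.symm, fun j hj => ?_⟩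
  by_contra hji
  exact hj (by simp [update_of_ne hji])

/-- The `(r+1)`-cube is the product of an `r`-cube and an edge in direction `j`; this serves both to
build cubes and to split them. -/
theorem hypercube_adj_insertNth {r : ℕ} (j : Fin (r + 1)) (b c : Bool) (x y : Fin r → Bool) :
    (hypercube (r + 1)).Adj (j.insertNth b x : Fin (r + 1) → Bool)
      (j.insertNth c y : Fin (r + 1) → Bool) ↔
      (b = c ∧ (hypercube r).Adj x y) ∨ (b ≠ c ∧ x = y) := by
  constructor
  · rintro ⟨i, hi, hu⟩
    by_cases hbc : b = c
    · refine Or.inl ⟨hbc, ?_⟩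
      induction i using j.succAboveCases with
      | x => simp [hbc] at hi
      | p i =>
        refine ⟨i, by simpa using hi, fun l hl => ?_⟩
        exact Fin.succAbove_right_injective (hu (j.succAbove l) (by simpa using hl))
    · refine Or.inr ⟨hbc, ?_⟩
      have hj := hu j (by simpa using hbc)
      ext1 l
      by_contra hl
      exact Fin.succAbove_ne j l ((hu (j.succAbove l) (by simpa using hl)).trans hj.symm)
  · rintro (⟨rfl, i, hi, hu⟩ | ⟨hbc, rfl⟩)
    · refine ⟨j.succAbove i, by simpa using hi, fun l hl => ?_⟩
      induction l using j.succAboveCases with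
      | x => simp at hl
      | p l => rw [hu l (by simpa using hl)]
    · refine ⟨j, by simpa using hbc, fun l hl => ?_⟩
      induction l using j.succAboveCases with
      | x => rfl
      | p l => simp at hl

/-- A property of binary vectors that survives changes of single coordinates holds everywhere as
soon as it holds somewhere. -/
theorem forall_of_update {r : ℕ} {P : (Fin r → Bool) → Prop} {x₀ : Fin r → Bool} (h₀ : P x₀)
    (hP : ∀ x i c, P x → P (update x i c)) (y : Fin r → Bool) : P y := by
  have key : ∀ s : Finset (Fin r), P (s.piecewise y x₀) := by
    intro s
    induction s using Finset.induction with
    | empty => simpa using h₀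
    | insert a s _ ih => rw [Finset.piecewise_insert]; exact hP _ _ _ ih
  simpa using key Finset.univ

/-- If the vertices of a graph carry levels such that adjacent vertices differ by at most one level
and every vertex has at most one neighbour on the next level and at most one on the previous level,
then a cube lies in a single level, or is split by one of its directions between two levels. -/
theorem level_dichotomy {V : Type*} {R : V → V → Prop} (h : V → ℕ) {r : ℕ}
    {f : (Fin r → Bool) → V} (hf : Injective f)
    (hadj : ∀ x y, (hypercube r).Adj x y → R (f x) (f y))
    (hle : ∀ x y, (hypercube r).Adj x y → h (f y) ≤ h (f x) + 1)
    (hup : ∀ u v w, R u v → R u w → h v = h u + 1 → h w = h u + 1 → v = w)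
    (hdown : ∀ u v w, R u v → R u w → h v + 1 = h u → h w + 1 = h u → v = w) :
    (∃ a, ∀ x, h (f x) = a) ∨
      ∃ (j : Fin r) (b : Bool) (a : ℕ), ∀ x,
        h (f (update x j b)) = a ∧ h (f (update x j (!b))) = a + 1 := by
  by_cases hc : ∀ x y, (hypercube r).Adj x y → h (f y) ≤ h (f x)
  · refine Or.inl ⟨h (f fun _ => false), fun y => ?_⟩
    refine forall_of_update (P := fun y => h (f y) = h (f fun _ => false))
      (x₀ := fun _ => false) rfl (fun x i c hx => ?_) y
    by_cases hci : c = x i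
    · simpa [hci] using hx
    · have hxy := hypercube_adj_update x hci
      have := hc _ _ hxy
      have := hc _ _ hxy.symm
      omega
  · push Not at hc
    obtain ⟨x₀, y₀, hxy, hlt⟩ := hc
    obtain ⟨j, hj, hju⟩ := id hxy
    have hy₀ : y₀ = update x₀ j (!x₀ j) := by
      ext1 i
      by_cases hi : i = j
      · subst hi; simpa using (Bool.eq_not_of_ne (Ne.symm hj))
      · rw [update_of_ne hi]
        by_contra hne
        exact hi (hju i (Ne.symm hne))
    refine Or.inr ⟨j, x₀ j, h (f x₀), ?_⟩
    refine forall_of_update (x₀ := x₀) ⟨by simp, ?_⟩ ?_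
    · have := hle _ _ hxy
      rw [← hy₀]; omega
    · rintro x i c ⟨h1, h2⟩
      by_cases hij : i = j
      · subst hij; simpa using ⟨h1, h2⟩
      by_cases hci : c = x i
      · simpa [hci] using ⟨h1, h2⟩
      have hcomm : ∀ d, update (update x i c) j d = update (update x j d) i c :=
        fun d => update_comm (Ne.symm hij) d c x |>.symm
      rw [hcomm, hcomm]
      have e1 := hypercube_adj_update (update x j (x₀ j)) (i := i) (c := c)
        (by simpa [update_of_ne hij] using hci)
      have e2 := hypercube_adj_update (update x j (!x₀ j)) (i := i) (c := c)
        (by simpa [update_of_ne hij] using hci)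
      have e3 := hypercube_adj_update (update x j (x₀ j)) (i := j) (c := !x₀ j) (by simp)
      have e4 := hypercube_adj_update (update (update x j (x₀ j)) i c) (i := j) (c := !x₀ j)
        (by simp [update_of_ne (Ne.symm hij)])
      rw [← hcomm, update_idem, hcomm, hcomm] at e4
      rw [update_idem] at e3
      have n1 : update x j (!x₀ j) ≠ update (update x j (x₀ j)) i c := fun he => by
        have := congrFun he j
        simp [update_of_ne (Ne.symm hij)] at this
      have n2 : update x j (x₀ j) ≠ update (update x j (!x₀ j)) i c := fun he => by
        have := congrFun he j
        simp [update_of_ne (Ne.symm hij)] at this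
      generalize update (update x j (x₀ j)) i c = w at *
      generalize update (update x j (!x₀ j)) i c = w' at *
      generalize update x j (x₀ j) = u at *
      generalize update x j (!x₀ j) = u' at *
      have a1 := hle _ _ e1
      have a1' := hle _ _ e1.symm
      have a2 := hle _ _ e2
      have a2' := hle _ _ e2.symm
      have a4 := hle _ _ e4
      -- In the square `u, u', w, w'`, `u'` is already the upper neighbour of `u`, so `w` cannot
      -- rise; `u` is already the lower neighbour of `u'`, so `w'` cannot fall. As `w` and `w'` are
      -- adjacent, both keep their levels.
      have b1 : h (f w) ≠ h (f u) + 1 := fun hw =>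
        n1 (hf (hup _ _ _ (hadj _ _ e3) (hadj _ _ e1) (by omega) hw))
      have b2 : h (f w') + 1 ≠ h (f u') := fun hw =>
        n2 (hf (hdown _ _ _ (hadj _ _ e3.symm) (hadj _ _ e2) (by omega) hw))
      omega

/-! ### Adjacency of words -/

theorem step_cons {k a b : ℕ} {u v : List ℕ} :
    Step k (a :: u) (b :: v) ↔ (a = b ∧ Step k u v) ∨ (b = a + 1 ∧ a + 1 < k ∧ u = v) ∨
      (1 ≤ k ∧ a = k - 1 ∧ b = k ∧ ∃ s, u = (k - 1) :: s ∧ v = k :: s) := by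
  constructor
  · rintro (⟨p, s, i, hi, h1, h2⟩ | ⟨p, s, hk, h1, h2⟩)
    · cases p with
      | nil => simp at h1 h2; right; left; simp_all
      | cons c p =>
        simp at h1 h2
        exact Or.inl ⟨by rw [h1.1, h2.1], Or.inl ⟨p, s, i, hi, by simpa using h1.2,
          by simpa using h2.2⟩⟩
    · cases p with
      | nil => simp at h1 h2; exact Or.inr (Or.inr ⟨hk, h1.1, h2.1, s, h1.2, h2.2⟩)
      | cons c p =>
        simp at h1 h2
        exact Or.inl ⟨by rw [h1.1, h2.1], Or.inr ⟨p, s, hk, by simpa using h1.2,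
          by simpa using h2.2⟩⟩
  · rintro (⟨rfl, ⟨p, s, i, hi, rfl, rfl⟩ | ⟨p, s, hk, rfl, rfl⟩⟩ | ⟨rfl, hk, rfl⟩ |
      ⟨hk, rfl, rfl, s, rfl, rfl⟩)
    · exact Or.inl ⟨a :: p, s, i, hi, rfl, rfl⟩
    · exact Or.inr ⟨a :: p, s, hk, rfl, rfl⟩
    · exact Or.inl ⟨[], u, a, hk, rfl, rfl⟩
    · exact Or.inr ⟨[], s, hk, rfl, rfl⟩

/-- Adjacency of words: one arises from the other by a single replacement. -/
def WAdj (k : ℕ) (u v : List ℕ) : Prop := Step k u v ∨ Step k v u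

theorem WAdj.symm {k : ℕ} {u v : List ℕ} (h : WAdj k u v) : WAdj k v u := Or.symm h

theorem wAdj_append {k : ℕ} (p u v : List ℕ) : WAdj k (p ++ u) (p ++ v) ↔ WAdj k u v := by
  induction p with
  | nil => rfl
  | cons a p ih =>
    rw [← ih]
    simp only [WAdj, List.cons_append, step_cons]
    constructor
    · rintro ((⟨-, h⟩ | ⟨h, -⟩ | ⟨h, h', h'', -⟩) | (⟨-, h⟩ | ⟨h, -⟩ | ⟨h, h', h'', -⟩)) <;>
        first | exact Or.inl h | exact Or.inr h | omega
    · rintro (h | h) <;> simp [h]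

theorem WAdj.level_le {k a b : ℕ} {u v : List ℕ} (h : WAdj k (a :: u) (b :: v)) : b ≤ a + 1 := by
  simp only [WAdj, step_cons] at h
  omega

/-- The neighbour one level up is determined by the word, and likewise the one a level down: the
uniqueness that `level_dichotomy` requires. -/
theorem wAdj_succ {k a : ℕ} {u v : List ℕ} :
    WAdj k (a :: u) ((a + 1) :: v) ↔ (a + 1 < k ∧ u = v) ∨
      (a + 1 = k ∧ ∃ s, u = a :: s ∧ v = (a + 1) :: s) := by
  simp only [WAdj, step_cons]
  constructor
  · rintro ((⟨h, -⟩ | ⟨-, h⟩ | ⟨h, h', h'', s, h1, h2⟩) | (⟨h, -⟩ | ⟨h, -⟩ | ⟨h, h', h'', -⟩))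
    · omega
    · exact Or.inl h
    · exact Or.inr ⟨h'', s, by rw [h1, h'], by rw [h2, h'']⟩
    all_goals omega
  · rintro (h | ⟨rfl, h⟩)
    · exact Or.inl (Or.inr (Or.inl ⟨trivial, h⟩))
    · exact Or.inl (Or.inr (Or.inr ⟨by omega, rfl, rfl, h⟩))

/-! ### Cubes of words -/

/-- `IsCube k n r S`: the words of `S` are `k`-Pell strings of length `n`, and they induce an
`r`-cube. -/
def IsCube (k : ℕ) (n r : ℤ) (S : Set (List ℕ)) : Prop :=
  ∃ s : ℕ, (s : ℤ) = r ∧ ∃ f : (Fin s → Bool) → List ℕ, Injective f ∧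
    (∀ x, IsPellString k (f x) ∧ ((f x).length : ℤ) = n) ∧
    (∀ x y, WAdj k (f x) (f y) ↔ (hypercube s).Adj x y) ∧ Set.range f = S

theorem IsCube.nonempty {k : ℕ} {n r : ℤ} {S : Set (List ℕ)} (h : IsCube k n r S) :
    S.Nonempty := by
  obtain ⟨s, -, f, -, -, -, rfl⟩ := h
  exact Set.range_nonempty f

/-- The words `p t` and `q t` with `t ∈ T`. -/
def glue (p q : List ℕ) (T : Set (List ℕ)) : Set (List ℕ) :=
  {w | ∃ t ∈ T, w = p ++ t ∨ w = q ++ t}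

theorem IsCube.glue_self {k : ℕ} {n r : ℤ} {T : Set (List ℕ)} {p : List ℕ}
    (hp : ∀ w, IsPellString k w → IsPellString k (p ++ w))
    (hT : IsCube k (n - p.length) r T) : IsCube k n r (glue p p T) := by
  obtain ⟨s, hs, f, hf, hP, hA, rfl⟩ := hT
  refine ⟨s, hs, fun x => p ++ f x, fun x y h => hf (List.append_cancel_left h), fun x => ?_,
    fun x y => by rw [wAdj_append, hA], ?_⟩
  · refine ⟨hp _ (hP x).1, ?_⟩
    have := (hP x).2
    simp only [List.length_append, Nat.cast_add]
    omega
  · ext w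
    simp [glue, eq_comm]

/-- `hadj` says that the edges between the two copies form exactly the matching `p t – q t`, so the
union is the product of the cube with an edge; coordinate 0 selects the copy. -/
theorem IsCube.glue_of_wAdj {k : ℕ} {n r : ℤ} {T : Set (List ℕ)} {p q : List ℕ}
    (hp : ∀ w, IsPellString k w → IsPellString k (p ++ w))
    (hq : ∀ w, IsPellString k w → IsPellString k (q ++ w))
    (hl : p.length = q.length) (hpq : p ≠ q)
    (hadj : ∀ u v, WAdj k (p ++ u) (q ++ v) ↔ u = v)
    (hT : IsCube k (n - q.length) (r - 1) T) : IsCube k n r (glue p q T) := by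
  obtain ⟨s, hs, f, hf, hP, hA, rfl⟩ := hT
  set F : Bool → (Fin s → Bool) → List ℕ := fun b x => (if b then q else p) ++ f x with hF
  have hA' : ∀ b c x y, WAdj k (F b x) (F c y) ↔
      (b = c ∧ (hypercube s).Adj x y) ∨ (b ≠ c ∧ x = y) := by
    intro b c x y
    have h1 : WAdj k (q ++ f x) (p ++ f y) ↔ x = y := by
      rw [← hf.eq_iff, eq_comm, ← hadj]
      exact ⟨WAdj.symm, WAdj.symm⟩
    cases b <;> cases c <;> simp [hF, wAdj_append, hadj, hA, hf.eq_iff, h1]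
  have hI : ∀ b c x y, F b x = F c y → b = c ∧ x = y := by
    intro b c x y h
    have hbc : b = c := by
      cases b <;> cases c <;> simp [hF] at h ⊢
      · exact hpq (List.append_inj h hl).1
      · exact hpq (List.append_inj h hl.symm).1.symm
    subst hbc
    exact ⟨rfl, hf (List.append_cancel_left h)⟩
  refine ⟨s + 1, by push_cast; omega, fun z => F (z 0) ((0 : Fin (s + 1)).removeNth z),
    fun x y h => ?_, fun x => ?_, fun x y => ?_, ?_⟩
  · obtain ⟨h1, h2⟩ := hI _ _ _ _ h
    rw [← Fin.insertNth_self_removeNth 0 x, ← Fin.insertNth_self_removeNth 0 y, h1, h2]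
  · have := hP ((0 : Fin (s + 1)).removeNth x)
    cases hx : x 0
    · exact ⟨by simpa [hF, hx] using hp _ this.1, by
        simp only [hF, hx, List.length_append, Nat.cast_add, this.2]; simp [hl]⟩
    · exact ⟨by simpa [hF, hx] using hq _ this.1, by
        simp only [hF, hx, List.length_append, Nat.cast_add, this.2]; simp⟩
  · rw [hA', ← hypercube_adj_insertNth 0, Fin.insertNth_self_removeNth,
      Fin.insertNth_self_removeNth]
  · ext w
    constructor
    · rintro ⟨z, rfl⟩
      refine ⟨_, ⟨(0 : Fin (s + 1)).removeNth z, rfl⟩, ?_⟩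
      cases hz : z 0 <;> simp [hF, hz]
    · rintro ⟨_, ⟨x, rfl⟩, rfl | rfl⟩
      · exact ⟨(0 : Fin (s + 1)).insertNth false x, by simp [hF]⟩
      · exact ⟨(0 : Fin (s + 1)).insertNth true x, by simp [hF]⟩

/-! ### Splitting off the first block -/

/-- First blocks of cubes: a letter, the block `kk`, or one of the edges `a – a+1` and
`(k-1)(k-1) – kk`. -/
abbrev Block (k : ℕ) : Type := Fin k ⊕ Unit ⊕ Fin (k - 1) ⊕ Unit

/-- The lower end of a block. -/
def Block.lo {k : ℕ} : Block k → List ℕ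
  | .inl a => [a]
  | .inr (.inl _) => [k, k]
  | .inr (.inr (.inl a)) => [a]
  | .inr (.inr (.inr _)) => [k - 1, k - 1]

/-- The upper end of a block. -/
def Block.hi {k : ℕ} : Block k → List ℕ
  | .inl a => [a]
  | .inr (.inl _) => [k, k]
  | .inr (.inr (.inl a)) => [a + 1]
  | .inr (.inr (.inr _)) => [k, k]

/-- The dimension of a block. -/
def Block.dim {k : ℕ} : Block k → ℤ
  | .inl _ => 0
  | .inr (.inl _) => 0
  | .inr (.inr (.inl _)) => 1
  | .inr (.inr (.inr _)) => 1

theorem isCube_glue_block {k : ℕ} (hk : 1 ≤ k) {n r : ℤ} (β : Block k) {T : Set (List ℕ)}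
    (hT : IsCube k (n - β.hi.length) (r - β.dim) T) : IsCube k n r (glue β.lo β.hi T) := by
  rcases β with a | a | a | a
  · exact IsCube.glue_self (fun w hw => .letter _ _ a.2 hw) (by simpa [Block.dim, Block.lo, Block.hi] using hT)
  · exact IsCube.glue_self (fun w hw => .double _ hw) (by simpa [Block.dim, Block.lo, Block.hi] using hT)
  · have ha := a.2
    refine IsCube.glue_of_wAdj (fun w hw => .letter _ _ (by omega) hw)
      (fun w hw => .letter _ _ (by omega) hw) rfl (by simp [Block.lo, Block.hi]) ?_ hT
    intro u v
    simp only [Block.lo, Block.hi, List.cons_append, List.nil_append, wAdj_succ]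
    constructor
    · rintro (h | h)
      · exact h.2
      · omega
    · exact fun h => Or.inl ⟨by omega, h⟩
  · obtain ⟨k, rfl⟩ : ∃ m, k = m + 1 := ⟨k - 1, by omega⟩
    refine IsCube.glue_of_wAdj
      (fun w hw => .letter _ _ (by omega) (.letter _ _ (by omega) hw))
      (fun w hw => .double _ hw) rfl (by simp [Block.lo, Block.hi]) ?_ hT
    intro u v
    simp [Block.lo, Block.hi, wAdj_succ, eq_comm]

/-- The set of first letters has minimum `lo.headI` and maximum `hi.headI`, and this pair tells all
blocks apart. The rest is then read off from the words that begin with `hi`. -/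
theorem glue_block_injective {k : ℕ} (hk : 1 ≤ k) {β γ : Block k} {T U : Set (List ℕ)}
    (hT : T.Nonempty) (hU : U.Nonempty) (h : glue β.lo β.hi T = glue γ.lo γ.hi U) :
    β = γ ∧ T = U := by
  have hd : ∀ (δ : Block k) (W : Set (List ℕ)), W.Nonempty →
      List.headI '' glue δ.lo δ.hi W = {δ.lo.headI, δ.hi.headI} := by
    rintro δ W ⟨w, hw⟩
    ext a
    constructor
    · rintro ⟨_, ⟨t, -, rfl | rfl⟩, rfl⟩
      · left; rcases δ with _ | _ | _ | _ <;> rfl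
      · right; rcases δ with _ | _ | _ | _ <;> rfl
    · rintro (rfl | rfl)
      · exact ⟨δ.lo ++ w, ⟨w, hw, Or.inl rfl⟩, by rcases δ with _ | _ | _ | _ <;> rfl⟩
      · exact ⟨δ.hi ++ w, ⟨w, hw, Or.inr rfl⟩, by rcases δ with _ | _ | _ | _ <;> rfl⟩
  have hle : ∀ δ : Block k, δ.lo.headI ≤ δ.hi.headI := by
    rintro (_ | _ | _ | _) <;> simp [Block.lo, Block.hi]
  have hpair : ({β.lo.headI, β.hi.headI} : Set ℕ) = {γ.lo.headI, γ.hi.headI} := by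
    rw [← hd β T hT, ← hd γ U hU, h]
  have hβ := hle β
  have hγ := hle γ
  rw [Set.pair_eq_pair_iff] at hpair
  have h1 : β.lo.headI = γ.lo.headI := by omega
  have h2 : β.hi.headI = γ.hi.headI := by omega
  have hβγ : β = γ := by
    rcases β with a | a | a | a <;> rcases γ with b | b | b | b <;>
      simp [Block.lo, Block.hi] at h1 h2 ⊢ <;> omega
  subst hβγ
  have hrec : ∀ W : Set (List ℕ), ∀ t, t ∈ W ↔ β.hi ++ t ∈ glue β.lo β.hi W := by
    intro W t
    constructor
    · exact fun ht => ⟨t, ht, Or.inr rfl⟩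
    · rintro ⟨s, hs, he | he⟩
      · rcases β with a | a | a | a <;> simp [Block.lo, Block.hi] at he
        · rwa [he]
        · rwa [he]
        · omega
      · rwa [List.append_cancel_left he]
  exact ⟨rfl, by ext t; rw [hrec T, hrec U, h]⟩

theorem IsPellString.tail_of_cons {k a : ℕ} {w : List ℕ} (h : IsPellString k (a :: w))
    (ha : a < k) : IsPellString k w := by
  cases h with
  | letter _ _ _ h => exact h
  | double => omega

theorem IsPellString.tail_of_double {k : ℕ} {w : List ℕ} (h : IsPellString k (k :: w)) :
    ∃ v, w = k :: v ∧ IsPellString k v := by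
  cases h with
  | letter _ _ h => omega
  | double v h => exact ⟨v, rfl, h⟩

theorem isCube_of_glue_self {k s : ℕ} {n : ℤ} {p : List ℕ} {f g : (Fin s → Bool) → List ℕ}
    (hf : Injective f) (hA : ∀ x y, WAdj k (f x) (f y) ↔ (hypercube s).Adj x y)
    (hn : ∀ x, ((f x).length : ℤ) = n)
    (hfg : ∀ x, f x = p ++ g x) (hg : ∀ x, IsPellString k (g x)) :
    IsCube k (n - p.length) s (Set.range g) := by
  refine ⟨s, rfl, g, fun x y h => hf (by rw [hfg, hfg, h]), fun x => ⟨hg x, ?_⟩, fun x y => ?_, rfl⟩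
  · have := hn x
    rw [hfg] at this
    simp only [List.length_append, Nat.cast_add] at this
    omega
  · rw [← hA, hfg, hfg, wAdj_append]

theorem exists_block {k : ℕ} {n r : ℤ} (hn : n ≠ 0) {S : Set (List ℕ)}
    (hS : IsCube k n r S) : ∃ (β : Block k) (T : Set (List ℕ)),
      IsCube k (n - β.hi.length) (r - β.dim) T ∧ glue β.lo β.hi T = S := by
  obtain ⟨s, rfl, f, hf, hP, hA, rfl⟩ := hS
  have hne : ∀ x, ∃ a w, f x = a :: w := by
    intro x
    have := (hP x).2
    cases hx : f x with
    | nil => simp [hx] at this; omega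
    | cons a w => exact ⟨a, w, rfl⟩
  choose a w hfx using hne
  have hhead : ∀ x, (f x).headI = a x := fun x => by rw [hfx]; rfl
  -- Empty words are excluded because `headI` gives them the default value 0.
  let R : List ℕ → List ℕ → Prop := fun u v => u ≠ [] ∧ v ≠ [] ∧ WAdj k u v
  have hRsymm : ∀ u v w, R u v → R u w → v.headI = u.headI + 1 → w.headI = u.headI + 1 →
      v = w := by
    rintro (_ | ⟨a, u⟩) (_ | ⟨b, v⟩) (_ | ⟨c, w⟩) ⟨h1, h2, h3⟩ ⟨h1', h2', h3'⟩ hb hc <;>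
      try contradiction
    simp only [List.headI_cons] at hb hc
    subst hb hc
    rw [wAdj_succ] at h3 h3'
    grind
  have hRdown : ∀ u v w, R u v → R u w → v.headI + 1 = u.headI → w.headI + 1 = u.headI →
      v = w := by
    rintro (_ | ⟨a, u⟩) (_ | ⟨b, v⟩) (_ | ⟨c, w⟩) ⟨h1, h2, h3⟩ ⟨h1', h2', h3'⟩ hb hc <;>
      try contradiction
    simp only [List.headI_cons] at hb hc
    subst hb
    obtain rfl : c = b := by omega
    replace h3 := wAdj_succ.1 h3.symm
    replace h3' := wAdj_succ.1 h3'.symm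
    grind
  rcases level_dichotomy (R := R) List.headI hf
    (fun x y h => ⟨by simp [hfx], by simp [hfx], (hA x y).2 h⟩)
    (fun x y h => by
      have := (hA x y).2 h
      rw [hhead, hhead]
      rw [hfx, hfx] at this
      exact this.level_le) hRsymm hRdown with ⟨b, hb⟩ | ⟨j, c, b, hb⟩
  · have hfb : ∀ x, f x = b :: w x := fun x => by rw [← hb x, hhead, ← hfx]
    by_cases hbk : b < k
    · refine ⟨.inl ⟨b, hbk⟩, Set.range w, ?_, ?_⟩
      · simpa [Block.dim, Block.hi] using isCube_of_glue_self (p := [b]) hf hA (fun x => (hP x).2) hfb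
          (fun x => by have := (hP x).1; rw [hfb] at this; exact this.tail_of_cons hbk)
      · ext v
        simp [glue, Block.lo, Block.hi, hfb, eq_comm]
    -- The letter `k` occurs only in pairs, so every word starts with `kk`.
    · obtain rfl : b = k := by
        have := (hP fun _ => false).1.le b (by simp [hfb])
        omega
      have : ∀ x, ∃ v, w x = b :: v ∧ IsPellString b v := fun x => by
        have := (hP x).1; rw [hfb] at this; exact this.tail_of_double
      choose v hv hvP using this
      have hfv : ∀ x, f x = [b, b] ++ v x := fun x => by rw [hfb, hv]; rfl
      refine ⟨.inr (.inl ()), Set.range v, ?_, ?_⟩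
      · simpa [Block.dim, Block.hi] using isCube_of_glue_self (p := [b, b]) hf hA (fun x => (hP x).2) hfv hvP
      · ext v
        simp [glue, Block.lo, Block.hi, hfv, eq_comm]
  · obtain ⟨s, rfl⟩ : ∃ m, s = m + 1 := ⟨s - 1, by have := j.2; omega⟩
    let F : Bool → (Fin s → Bool) → List ℕ := fun d y => f (j.insertNth d y)
    have hrange : ∀ v, v ∈ Set.range f ↔ ∃ y, v = F c y ∨ v = F (!c) y := by
      intro v
      constructor
      · rintro ⟨x, rfl⟩
        refine ⟨j.removeNth x, ?_⟩
        have hx : f x = F (x j) (j.removeNth x) := by simp only [F, Fin.insertNth_self_removeNth]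
        by_cases hc : x j = c
        · left; rw [hx, hc]
        · right; rw [hx, Bool.eq_not_of_ne hc]
      · rintro ⟨y, rfl | rfl⟩ <;> exact ⟨_, rfl⟩
    have hFI : ∀ d, Injective (F d) := fun d => hf.comp (Fin.insertNth_right_injective (α := fun _ => Bool) d)
    have hFA : ∀ d x y, WAdj k (F d x) (F d y) ↔ (hypercube s).Adj x y := fun d x y => by
      simp only [F, hA, hypercube_adj_insertNth]; simp
    have hFv : ∀ y, WAdj k (F c y) (F (!c) y) := fun y => by
      simp only [F, hA, hypercube_adj_insertNth]; simp
    have hFl : ∀ y, (F c y).headI = b ∧ (F (!c) y).headI = b + 1 := fun y => by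
      simpa [F] using hb (j.insertNth c y)
    have hlo : ∀ y, ∃ u, F c y = b :: u := fun y => ⟨w (j.insertNth c y), by
      rw [← (hFl y).1]; simp only [F]; rw [hhead, ← hfx]⟩
    have hhi : ∀ y, ∃ u, F (!c) y = (b + 1) :: u := fun y => ⟨w (j.insertNth (!c) y), by
      rw [← (hFl y).2]; simp only [F]; rw [hhead, ← hfx]⟩
    choose u hu using hlo
    choose v hv using hhi
    have huv : ∀ y, (b + 1 < k ∧ u y = v y) ∨
        (b + 1 = k ∧ ∃ s, u y = b :: s ∧ v y = (b + 1) :: s) := fun y => by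
      have := hFv y
      rwa [hu, hv, wAdj_succ] at this
    have hFP : ∀ d y, IsPellString k (F d y) := fun d y => (hP _).1
    have hFn : ∀ d y, ((F d y).length : ℤ) = n := fun d y => (hP _).2
    by_cases hbk : b + 1 < k
    · have huv' : ∀ y, v y = u y := fun y => by
        rcases huv y with h | h
        · exact h.2.symm
        · omega
      refine ⟨.inr (.inr (.inl ⟨b, by omega⟩)), Set.range u, ?_, ?_⟩
      · simpa [Block.dim, Block.hi] using isCube_of_glue_self (p := [b]) (hFI c) (hFA c) (hFn c) hu
          (fun x => by have := hFP c x; rw [hu] at this; exact this.tail_of_cons (by omega))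
      · ext x
        rw [hrange]
        simp [glue, Block.lo, Block.hi, hu, hv, huv']
    -- At the top level each edge in direction `j` replaces `(k-1)(k-1)` by `kk`, which forces the
    -- second letter in both faces.
    · have huv' : ∀ y, b + 1 = k ∧ ∃ s, u y = b :: s ∧ v y = (b + 1) :: s := fun y =>
        (huv y).resolve_left fun h => hbk h.1
      obtain rfl : b + 1 = k := (huv' fun _ => false).1
      choose t ht using fun y => (huv' y).2
      refine ⟨.inr (.inr (.inr ())), Set.range t, ?_, ?_⟩
      · simpa [Block.dim, Block.hi] using isCube_of_glue_self (p := [b, b]) (hFI c) (hFA c) (hFn c)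
          (fun y => by rw [hu, (ht y).1]; rfl)
          (fun x => by
            have := hFP c x
            rw [hu, (ht x).1] at this
            exact (this.tail_of_cons (by omega)).tail_of_cons (by omega))
      · ext x
        rw [hrange]
        simp [glue, Block.lo, Block.hi, hu, hv, (ht _).1, (ht _).2]

/-! ### Counting -/

/-- The number of `r`-cubes of `k`-Pell strings of length `n`. -/
noncomputable def cubeNum (k : ℕ) (n r : ℤ) : ℕ := Nat.card {S // IsCube k n r S}

instance finite_isCube (k : ℕ) (n r : ℤ) : Finite {S // IsCube k n r S} := by
  have hfin : {w : List ℕ | IsPellString k w ∧ (w.length : ℤ) = n}.Finite := by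
    have : Set.Finite {w : List ℕ | IsPellString k w ∧ w.length = n.toNat} :=
      Set.finite_coe_iff.1 (instFinitePellString n.toNat k)
    exact this.subset fun w hw => ⟨hw.1, by have := hw.2; omega⟩
  refine (hfin.finite_subsets.subset ?_).to_subtype
  rintro _ ⟨s, -, f, -, hP, -, rfl⟩
  rintro _ ⟨x, rfl⟩
  exact hP x

/-- Cubes correspond to pairs of a block and a cube of the remaining words; summing over blocks
gives the four terms. Integer `n` and `r` let out-of-range terms vanish without truncated
subtraction. -/
theorem cubeNum_rec {k : ℕ} (hk : 1 ≤ k) {n : ℤ} (hn : n ≠ 0) (r : ℤ) :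
    cubeNum k n r = k * cubeNum k (n - 1) r + cubeNum k (n - 2) r
      + (k - 1) * cubeNum k (n - 1) (r - 1) + cubeNum k (n - 2) (r - 1) := by
  let Φ : (Σ β : Block k, {T // IsCube k (n - β.hi.length) (r - β.dim) T}) →
      {S // IsCube k n r S} := fun x => ⟨glue x.1.lo x.1.hi x.2.1, isCube_glue_block hk _ x.2.2⟩
  have hΦ : Bijective Φ := by
    constructor
    · rintro ⟨β, T, hT⟩ ⟨γ, U, hU⟩ h
      obtain ⟨rfl, rfl⟩ := glue_block_injective hk hT.nonempty hU.nonempty (congrArg Subtype.val h)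
      rfl
    · rintro ⟨S, hS⟩
      obtain ⟨β, T, hT, h⟩ := exists_block hn hS
      exact ⟨⟨β, T, hT⟩, Subtype.ext h⟩
  rw [cubeNum, ← Nat.card_eq_of_bijective Φ hΦ, Nat.card_sigma]
  simp only [Fintype.sum_sum_type, Block.hi, Block.dim, List.length_cons, List.length_nil,
    Finset.sum_const, Finset.card_univ, Fintype.card_fin, Fintype.card_unit, smul_eq_mul, sub_zero,
    Nat.cast_one, zero_add, one_mul, cubeNum, Nat.reduceAdd, Nat.cast_ofNat]
  ring

theorem cubeNum_eq_zero {k : ℕ} {n r : ℤ} (h : n < 0 ∨ r < 0) : cubeNum k n r = 0 := by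
  have : IsEmpty {S // IsCube k n r S} := by
    refine ⟨?_⟩
    rintro ⟨_, s, hs, f, -, hP, -⟩
    have := (hP fun _ => false).2
    omega
  simp [cubeNum]

theorem isCube_zero_iff {k r : ℕ} {S : Set (List ℕ)} :
    IsCube k 0 r S ↔ r = 0 ∧ S = {[]} := by
  constructor
  · rintro ⟨s, hs, f, hf, hP, -, rfl⟩
    have hnil : ∀ x, f x = [] := fun x => by simpa using (hP x).2
    obtain rfl : s = r := by exact_mod_cast hs
    refine ⟨?_, ?_⟩
    · cases s with
      | zero => rfl
      | succ s =>
        have := hf ((hnil fun _ => false).trans (hnil fun _ => true).symm)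
        simpa using congrFun this 0
    · ext w
      simp [hnil, eq_comm]
  · rintro ⟨rfl, rfl⟩
    refine ⟨0, rfl, fun _ => [], fun x y _ => Subsingleton.elim _ _, fun _ => ⟨.nil, rfl⟩,
      fun x y => ?_, by simp⟩
    constructor
    · rintro (h | h) <;> exact (Step.irrefl _ _ h).elim
    · rintro ⟨i, -⟩
      exact i.elim0

theorem cubeNum_zero (k r : ℕ) : cubeNum k 0 r = if r = 0 then 1 else 0 := by
  simp only [cubeNum, isCube_zero_iff]
  split_ifs with h <;> simp [h]

/-- Vertex sets of the graph are carried to sets of words by `Subtype.val`; a cube of words of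
length `n` always comes from such a set. -/
theorem cubeCount_pellGraph (n k r : ℕ) : cubeCount (pellGraph n k) r = cubeNum k n r := by
  have hS : ∀ S : Set (PellString n k),
      Nonempty ((pellGraph n k).induce S ≃g hypercube r) ↔ IsCube k n r (Subtype.val '' S) := by
    intro S
    constructor
    · rintro ⟨e⟩
      refine ⟨r, rfl, fun x => (e.symm x).1.1, ?_, fun x => ?_, fun x y => ?_, ?_⟩
      · exact Subtype.val_injective.comp (Subtype.val_injective.comp e.symm.injective)
      · exact ⟨(e.symm x).1.2.1, by exact_mod_cast (e.symm x).1.2.2⟩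
      · exact e.symm.map_adj_iff (v := x) (w := y)
      · ext w
        constructor
        · rintro ⟨x, rfl⟩
          exact ⟨_, (e.symm x).2, rfl⟩
        · rintro ⟨v, hv, rfl⟩
          exact ⟨e ⟨v, hv⟩, by simp⟩
    · rintro ⟨s, hs, f, hf, hP, hA, hr⟩
      obtain rfl : s = r := by exact_mod_cast hs
      let g : (Fin s → Bool) → PellString n k := fun x => ⟨f x, (hP x).1, by exact_mod_cast (hP x).2⟩
      have hg : Injective g := fun x y h => hf (congrArg Subtype.val h)
      obtain rfl : Set.range g = S := by
        apply Subtype.val_injective.image_injective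
        rw [← hr, ← Set.range_comp]
        rfl
      refine ⟨SimpleGraph.Iso.symm ⟨Equiv.ofInjective g hg, ?_⟩⟩
      intro x y
      exact hA x y
  refine Nat.card_eq_of_bijective
    (fun S => (⟨Subtype.val '' S.1, (hS S.1).1 S.2⟩ : {S // IsCube k n r S})) ⟨?_, ?_⟩
  · intro S T h
    exact Subtype.ext (Subtype.val_injective.image_injective (congrArg Subtype.val h))
  · rintro ⟨S, h⟩
    have himg : Subtype.val '' (Subtype.val ⁻¹' S : Set (PellString n k)) = S := by
      rw [Set.image_preimage_eq_iff]
      obtain ⟨s, -, f, -, hP, -, rfl⟩ := h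
      rintro _ ⟨x, rfl⟩
      exact ⟨⟨f x, (hP x).1, by exact_mod_cast (hP x).2⟩, rfl⟩
    exact ⟨⟨Subtype.val ⁻¹' S, (hS _).2 (by rwa [himg])⟩, Subtype.ext himg⟩

theorem coeff_cubePoly_pellGraph (n k r : ℕ) :
    (cubePoly (pellGraph n k)).coeff r = (cubeNum k n r : ℤ) := by
  rw [coeff_cubePoly, cubeCount_pellGraph]

theorem coeff_linear_mul (a b : ℤ) (p : Polynomial ℤ) (r : ℕ) :
    ((Polynomial.C a + Polynomial.C b * Polynomial.X) * p).coeff r =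
      a * p.coeff r + b * (if r = 0 then 0 else p.coeff (r - 1)) := by
  rw [add_mul, Polynomial.coeff_add, Polynomial.coeff_C_mul, mul_assoc, Polynomial.coeff_C_mul]
  cases r <;> simp [Polynomial.coeff_X_mul]

theorem cast_cubeNum_rec {k : ℕ} (hk : 1 ≤ k) {n : ℤ} (hn : n ≠ 0) (r : ℤ) :
    (cubeNum k n r : ℤ) = k * cubeNum k (n - 1) r + ((k : ℤ) - 1) * cubeNum k (n - 1) (r - 1)
      + (cubeNum k (n - 2) r + cubeNum k (n - 2) (r - 1)) := by
  rw [cubeNum_rec hk hn]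
  push_cast [hk]
  ring

theorem cubeNum_sub_one (k n r : ℕ) : (cubeNum k n ((r : ℤ) - 1) : ℤ) =
    if r = 0 then 0 else (cubePoly (pellGraph n k)).coeff (r - 1) := by
  cases r with
  | zero => simp [cubeNum_eq_zero]
  | succ r => simp [coeff_cubePoly_pellGraph]

theorem cubePoly_zero (k : ℕ) : cubePoly (pellGraph 0 k) = 1 := by
  ext r
  rw [coeff_cubePoly_pellGraph, Polynomial.coeff_one]
  exact_mod_cast cubeNum_zero k r

theorem cubePoly_one {k : ℕ} (hk : 1 ≤ k) : cubePoly (pellGraph 1 k) =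
    ((k : Polynomial ℤ) + ((k : Polynomial ℤ) - 1) * Polynomial.X) * cubePoly (pellGraph 0 k) := by
  ext r
  have h := coeff_linear_mul k ((k : ℤ) - 1) (cubePoly (pellGraph 0 k)) r
  have h0 := cubeNum_sub_one k 0 r
  have h1 : ((1 : ℕ) : ℤ) - 1 = (0 : ℕ) := rfl
  simp only [map_natCast, map_sub, map_one] at h
  -- The terms of length `-1` vanish, so the recurrence starts at `n = 1` with no second-order part.
  have h2 : ∀ t, cubeNum k (((1 : ℕ) : ℤ) - 2) t = 0 := fun t =>
    cubeNum_eq_zero (Or.inl (by norm_num))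
  rw [h, coeff_cubePoly_pellGraph, cast_cubeNum_rec hk (by norm_num), h2, h2, h1, h0,
    ← coeff_cubePoly_pellGraph]
  simp

theorem cubePoly_add_two {k : ℕ} (hk : 1 ≤ k) (n : ℕ) : cubePoly (pellGraph (n + 2) k) =
    ((k : Polynomial ℤ) + ((k : Polynomial ℤ) - 1) * Polynomial.X) *
      cubePoly (pellGraph (n + 1) k) + (1 + Polynomial.X) * cubePoly (pellGraph n k) := by
  ext r
  have h := coeff_linear_mul k ((k : ℤ) - 1) (cubePoly (pellGraph (n + 1) k)) r
  have h' := coeff_linear_mul 1 1 (cubePoly (pellGraph n k)) r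
  have h0 := cubeNum_sub_one k n r
  have h0' := cubeNum_sub_one k (n + 1) r
  have h1 : ((n + 2 : ℕ) : ℤ) - 1 = (n + 1 : ℕ) := by push_cast; ring
  have h2 : ((n + 2 : ℕ) : ℤ) - 2 = (n : ℕ) := by push_cast; ring
  simp only [map_natCast, map_sub, map_one, one_mul]
    at h h'
  rw [Polynomial.coeff_add, h, h', coeff_cubePoly_pellGraph, cast_cubeNum_rec hk (by omega), h1, h2,
    h0, h0', ← coeff_cubePoly_pellGraph, ← coeff_cubePoly_pellGraph]

theorem mk_cubePoly_mul_denom {k : ℕ} (hk : 1 ≤ k) :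
    PowerSeries.mk (fun n : ℕ => cubePoly (pellGraph n k)) * denom k = 1 := by
  ext1 n
  rw [denom, mul_sub, mul_sub, mul_one, mul_left_comm, mul_left_comm _ (PowerSeries.C _)]
  simp only [map_sub, PowerSeries.coeff_C_mul, PowerSeries.coeff_mk, PowerSeries.coeff_one]
  rcases n with _ | _ | n
  · simp [cubePoly_zero, pow_two, ← mul_assoc]
  · rw [PowerSeries.coeff_succ_mul_X, PowerSeries.coeff_mk, PowerSeries.coeff_mul_X_pow']
    simp [cubePoly_one hk]
  · rw [PowerSeries.coeff_succ_mul_X, PowerSeries.coeff_mk, add_assoc n, PowerSeries.coeff_mul_X_pow,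
      PowerSeries.coeff_mk, cubePoly_add_two hk]
    simp

end KPell

theorem mainTheorem7 (k : ℕ) (hk : 2 ≤ k) :
    IsUnit (KPell.denom k) ∧
      PowerSeries.mk (fun n : ℕ => KPell.cubePoly (KPell.pellGraph n k)) =
        Ring.inverse (KPell.denom k) := by
  have h := KPell.mk_cubePoly_mul_denom (k := k) (by omega)
  -- `Ring.inverse` is 0 at non-units, so invertibility is needed for the formula to have its
  -- intended meaning.
  have hu : IsUnit (KPell.denom k) := IsUnit.of_mul_eq_one_right _ h
  refine ⟨hu, ?_⟩
  rw [← one_mul (Ring.inverse _), Ring.eq_mul_inverse_iff_mul_eq _ _ _ hu, h]
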